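/- Let $F$ be a probability distribution on a measurable space $\mathcal X$, let $P$ be an $F$-invariant Markov transition kernel, and let $\{X_{st}\}_{t\ge 1}$, $s=1,\dots,m$ ($m\ge 1$), be independent stationary Markov chains with kernel $P$ and initial distribution $F$. Let $g:\mathcal X\to\mathbb R^p$ be measurable, $Y_{st}=g(X_{st})$, and write $\Upsilon(k)=\operatorname{Cov}_F(Y_{11},Y_{1,1+k})$ for $k\ge 0$, $\Upsilon(k)=\Upsilon(-k)^T$ for $k<0$, $$\Sigma=\sum_{k=-\infty}^{\infty}\Upsilon(k),\qquad \Phi^{(q)}=\sum_{k=-\infty}^{\infty}|k|^q\,\Upsilon(k).$$ With $\bar{\bar Y}=(mn)^{-1}\sum_{s=1}^m\sum_{t=1}^n Y_{st}$ put, for $k\ge 0$, $$\hat\Upsilon_{G,s}(k)=\frac1n\sum_{t=1}^{n-k}(Y_{st}-\bar{\bar Y})(Y_{s,t+k}-\bar{\bar Y})^T,\quad \hat\Upsilon_{G,s}(-k)=\hat\Upsilon_{G,s}(k)^T,\quad \hat\Upsilon_G(k)=\frac1m\sum_{s=1}^m\hat\Upsilon_{G,s}(k),$$ and let $\hat\Sigma_G=\sum_{k=-b_n+1}^{b_n-1}w(k/b_n)\,\hat\Upsilon_G(k)$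 be the globally-centered spectral variance (G-SV) estimator with truncation points $b_n\in\mathbb N$ and lag window $w:\mathbb R\to\mathbb R$. The window $w$ is bounded, even, continuous at all but finitely many points, satisfies $w(0)=1$, and $w$ and $w^2$ are integrable. Suppose that for some $q>0$ $$\lim_{x\to0}\frac{1-w(x)}{|x|^q}=k_q\in\mathbb R,$$ that $\mathbb E_F\|g(X)\|^{2+\delta}<\infty$ for some $\delta>0$, and that $P$ is polynomially ergodic of some order $\xi>(q+1+\epsilon)(1+2/\delta)$ with $\epsilon>0$, i.e. there is $M:\mathcal X\to[0,\infty)$ with $\mathbb E_F M<\infty$ and $\|P^n(x,\cdot)-F\|_{TV}\le M(x)\,n^{-\xi}$ for all $x\in\mathcal X$ and $n\ge1$. Suppose finally that $b_n\to\infty$ and $b_n^{q+1}/n\to0$ as $n\to\infty$. Then the series defining $\Sigma$ and $\Phi^{(q)}$ converge absolutely, the entries of $\hat\Sigma_G$ are integrable, and $$\lim_{n\to\infty} b_n^q\,\mathbb E\big[\hat\Sigma_G-\Sigma\big]=-k_q\,\Phi^{(q)}.$$ -/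

import Mathlib

open MeasureTheory ProbabilityTheory Filter Topology

noncomputable section

namespace GSV

/-- Total variation distance between two (finite) measures, `sup_A |μ A - ν A|` over
measurable sets `A`. -/
def tvDist {S : Type*} [MeasurableSpace S] (μ ν : Measure S) : ℝ :=
  ⨆ A : {A : Set S // MeasurableSet A}, |μ.real A.1 - ν.real A.1|

/-- The kernel `P` is polynomially ergodic of order `ξ` with limit `F`: there is
`M : S → [0, ∞)` with `E_F M < ∞` such that `‖Pⁿ(x, ·) - F‖_TV ≤ M(x) n^{-ξ}` for all
states `x` and all `n ≥ 1`. -/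
def PolynomiallyErgodic {S : Type*} [MeasurableSpace S] (P : Kernel S S) (F : Measure S)
    (ξ : ℝ) : Prop :=
  ∃ M : S → ℝ, (∀ x, 0 ≤ M x) ∧ Integrable M F ∧
    ∀ x, ∀ n : ℕ, 1 ≤ n → tvDist ((P ^ n) x) F ≤ M x * (n : ℝ) ^ (-ξ)

/-- `X 0, X 1, …` is a Markov chain on the probability space `(Ω, μ)` with transition kernel `P`
and initial distribution `F`. The Markov property says that
`μ(X (n+1) ∈ A | X 0, …, X n) = P (X n) A`, written out on the events `E` of
`σ(X 0, …, X n)`. -/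
structure IsMarkovChain {S Ω : Type*} [MeasurableSpace S] [MeasurableSpace Ω] (μ : Measure Ω)
    (P : Kernel S S) (F : Measure S) (X : ℕ → Ω → S) : Prop where
  measurable : ∀ t, Measurable (X t)
  initial : μ.map (X 0) = F
  markov : ∀ (n : ℕ) (E : Set Ω) (A : Set S),
    MeasurableSet[⨆ i : Fin (n + 1), MeasurableSpace.comap (X i) inferInstance] E →
    MeasurableSet A →
    μ (E ∩ X (n + 1) ⁻¹' A) = ∫⁻ ω in E, P (X n ω) A ∂μ

/-- A lag window: bounded, even, continuous at all but finitely many points, equal to `1` at `0`,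
integrable and square integrable. -/
structure IsLagWindow (w : ℝ → ℝ) : Prop where
  finite_discont : {x : ℝ | ¬ ContinuousAt w x}.Finite
  bounded : ∃ c : ℝ, 1 ≤ c ∧ ∀ x, |w x| ≤ c
  even : ∀ x, w (-x) = w x
  at_zero : w 0 = 1
  integrable_sq : Integrable (fun x => w x ^ 2)
  integrable_abs : Integrable (fun x => |w x|)

/-- Extension of a family of matrices from nonnegative lags to all lags, by
`A (-k) = (A k)ᵀ`. -/
def twoSided {p : ℕ} (A : ℕ → Matrix (Fin p) (Fin p) ℝ) (k : ℤ) : Matrix (Fin p) (Fin p) ℝ :=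
  if 0 ≤ k then A k.natAbs else (A k.natAbs).transpose

/-- Entrywise expectation of a random matrix. -/
def expect {p : ℕ} {Ω : Type*} [MeasurableSpace Ω] (μ : Measure Ω)
    (A : Ω → Matrix (Fin p) (Fin p) ℝ) : Matrix (Fin p) (Fin p) ℝ :=
  Matrix.of fun i j => ∫ ω, A ω i j ∂μ

section Population

variable {p : ℕ} {Ω : Type*} [MeasurableSpace Ω]

/-- The autocovariance `Υ(k) = Cov(Z 0, Z k)` of a stationary process `Z` at lag `k ∈ ℤ`, with
`Υ(-k) = Υ(k)ᵀ`. -/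
def autocov (μ : Measure Ω) (Z : ℕ → Ω → EuclideanSpace ℝ (Fin p)) :
    ℤ → Matrix (Fin p) (Fin p) ℝ :=
  twoSided fun k => Matrix.of fun i j => cov[fun ω => Z 0 ω i, fun ω => Z k ω j; μ]

/-- The long-run variance `Σ = ∑_{k ∈ ℤ} Υ(k)`. -/
def longRunVar (μ : Measure Ω) (Z : ℕ → Ω → EuclideanSpace ℝ (Fin p)) :
    Matrix (Fin p) (Fin p) ℝ :=
  ∑' k : ℤ, autocov μ Z k

/-- `Φ^{(q)} = ∑_{k ∈ ℤ} |k|^q Υ(k)`. -/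
def phi (μ : Measure Ω) (Z : ℕ → Ω → EuclideanSpace ℝ (Fin p)) (q : ℝ) :
    Matrix (Fin p) (Fin p) ℝ :=
  ∑' k : ℤ, (|(k : ℝ)| ^ q) • autocov μ Z k

end Population

section Estimators

/- The data of the `m` chains at a fixed outcome: `y s t` is the observation of chain `s` at the
`(t + 1)`-st time point, so the first `n` observations are `y s 0, …, y s (n - 1)`. -/

/-- Sample mean of the first `n` observations of one chain. -/
def chainMean {p : ℕ} (n : ℕ) (y : ℕ → EuclideanSpace ℝ (Fin p)) : EuclideanSpace ℝ (Fin p) :=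
  (n : ℝ)⁻¹ • ∑ t ∈ Finset.range n, y t

/-- Global mean over all `m` chains. -/
def globalMean {m p : ℕ} (n : ℕ) (y : Fin m → ℕ → EuclideanSpace ℝ (Fin p)) :
    EuclideanSpace ℝ (Fin p) :=
  (m : ℝ)⁻¹ • ∑ s, chainMean n (y s)

/-- Globally-centered autocovariance estimator of chain `s` at lag `k ≥ 0`:
`n⁻¹ ∑_{t=1}^{n-k} (Y_{s,t} - Ȳ) (Y_{s,t+k} - Ȳ)ᵀ` with `Ȳ` the global mean. -/
def gAcvf {m p : ℕ} (n : ℕ) (y : Fin m → ℕ → EuclideanSpace ℝ (Fin p)) (s : Fin m) (k : ℕ) :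
    Matrix (Fin p) (Fin p) ℝ :=
  (n : ℝ)⁻¹ • ∑ t ∈ Finset.range (n - k),
    Matrix.vecMulVec (y s t - globalMean n y).ofLp (y s (t + k) - globalMean n y).ofLp

/-- Average over the chains of the globally-centered autocovariance estimators, at lag
`k ∈ ℤ`. -/
def gAcvfAvg {m p : ℕ} (n : ℕ) (y : Fin m → ℕ → EuclideanSpace ℝ (Fin p)) (k : ℤ) :
    Matrix (Fin p) (Fin p) ℝ :=
  (m : ℝ)⁻¹ • ∑ s, twoSided (gAcvf n y s) k

/-- The globally-centered spectral variance estimator with lag window `w` and truncation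
point `b`. -/
def gsv {m p : ℕ} (w : ℝ → ℝ) (b n : ℕ) (y : Fin m → ℕ → EuclideanSpace ℝ (Fin p)) :
    Matrix (Fin p) (Fin p) ℝ :=
  ∑ k ∈ Finset.Icc (-(b : ℤ) + 1) ((b : ℤ) - 1), w ((k : ℝ) / (b : ℝ)) • gAcvfAvg n y k

end Estimators

end GSV

end

/-! The argument is entrywise and separates a deterministic limit from two errors of order `b / n`.

Decay: truncating `g` at a level `L` costs `L ^ (-δ)` by the moment condition, while for the
truncated functions total variation gives `L ^ 2 * k ^ (-ξ)`. Balancing the two in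
`abs_integral_mul_compProd_sub_mul_le_rpow` bounds the lag-`k` covariance by a constant times `|k| ^
(-r)`, with `r = ξ / (1 + 2 / δ) > q + 1`. This gives absolute convergence of both series.

Centering: by independence across chains and summability along each chain, the covariances among the
`mn` pooled observations have absolute row and column sums bounded by some `B`. Hence replacing the
true mean by the global mean moves each expected product by at most `3B / (mn)`
(`abs_integral_sub_mean_mul_sub_mean_sub_cov_le`), and the expected lag-`k` estimate is `(1 -
|k|/n)₊ Υ(k) + O(1/n)` uniformly in `k`.

Bias: at most `2b` lags enter, so the centering error and the factor `(1 - |k|/n)₊` contribute `O(b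
/ n)`, which is `O(b ^ (q + 1) / n)` after scaling by `b ^ q` and vanishes. What remains is `b ^ q`
times the windowed sum of `Υ` minus its full sum; its `k`-th term tends to `-kq |k| ^ q Υ(k)` and is
dominated by a multiple of `|k| ^ q |Υ(k)|`, so dominated convergence concludes
(`tendsto_windowed_sum`). -/

namespace GSV

/-! ### Covariance inequality from total variation and moments -/

section Mixing

variable {S : Type*} [MeasurableSpace S]

lemma abs_real_sub_le_tvDist (μ ν : Measure S) [IsProbabilityMeasure μ] [IsProbabilityMeasure ν]
    {A : Set S} (hA : MeasurableSet A) : |μ.real A - ν.real A| ≤ tvDist μ ν := by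
  refine le_ciSup (f := fun A : {A : Set S // MeasurableSet A} => |μ.real A.1 - ν.real A.1|)
    ⟨1, ?_⟩ ⟨A, hA⟩
  rintro _ ⟨B, rfl⟩
  have h1 : μ.real B.1 ≤ 1 := measureReal_le_one
  have h2 : ν.real B.1 ≤ 1 := measureReal_le_one
  have h3 : 0 ≤ μ.real B.1 := measureReal_nonneg
  have h4 : 0 ≤ ν.real B.1 := measureReal_nonneg
  exact abs_le.2 ⟨by linarith, by linarith⟩

/-- Layer cake: `h + L` takes values in `[0, 2L]`, so its integral is that of the tail probabilities
over `(0, 2L]`, and the tails under the two measures differ by at most the total variation distance.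
-/
lemma abs_integral_sub_le_tvDist (μ ν : Measure S) [IsProbabilityMeasure μ]
    [IsProbabilityMeasure ν] {h : S → ℝ} (hh : Measurable h) {L : ℝ} (hL : ∀ x, |h x| ≤ L) :
    |∫ x, h x ∂μ - ∫ x, h x ∂ν| ≤ 2 * L * tvDist μ ν := by
  have hint : ∀ ρ : Measure S, IsProbabilityMeasure ρ → Integrable h ρ := fun ρ _ =>
    Integrable.of_bound hh.aestronglyMeasurable L (ae_of_all _ hL)
  have key : ∀ ρ : Measure S, IsProbabilityMeasure ρ →
      ∫ x, h x ∂ρ + L = ∫ t in Set.Ioc 0 (2 * L), ρ.real {a | t ≤ h a + L} := by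
    intro ρ hρ
    have h1 : Integrable (fun x => h x + L) ρ := (hint ρ hρ).add (integrable_const L)
    rw [← h1.integral_eq_integral_Ioc_meas_le, integral_add (hint ρ hρ) (integrable_const L)]
    · simp
    · exact ae_of_all _ fun x => by simpa using by linarith [(abs_le.1 (hL x)).1]
    · exact ae_of_all _ fun x => by simpa using by linarith [(abs_le.1 (hL x)).2]
  have hI : ∀ ρ : Measure S, IsProbabilityMeasure ρ →
      IntegrableOn (fun t : ℝ => ρ.real {a | t ≤ h a + L}) (Set.Ioc 0 (2 * L)) := by
    intro ρ hρ
    have hanti : Antitone (fun t : ℝ => ρ.real {a | t ≤ h a + L}) := fun s t hst =>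
      measureReal_mono fun a (ha : t ≤ h a + L) => hst.trans ha
    exact (hanti.locallyIntegrable.integrableOn_isCompact isCompact_Icc).mono_set
      Set.Ioc_subset_Icc_self
  have hL0 : 0 ≤ L := by
    obtain ⟨x⟩ : Nonempty S := nonempty_of_isProbabilityMeasure μ
    exact (abs_nonneg _).trans (hL x)
  have e : ∫ x, h x ∂μ - ∫ x, h x ∂ν = ∫ t in Set.Ioc 0 (2 * L),
      (μ.real {a | t ≤ h a + L} - ν.real {a | t ≤ h a + L}) := by
    rw [integral_sub (hI μ inferInstance) (hI ν inferInstance), ← key μ inferInstance,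
      ← key ν inferInstance]
    ring
  rw [e]
  have := norm_setIntegral_le_of_norm_le_const (μ := volume) (s := Set.Ioc 0 (2 * L))
    (f := fun t => μ.real {a | t ≤ h a + L} - ν.real {a | t ≤ h a + L}) (C := tvDist μ ν)
    (by rw [Real.volume_Ioc]; exact ENNReal.ofReal_lt_top) (fun t _ => abs_real_sub_le_tvDist μ ν
      (measurableSet_le measurable_const (hh.add_const L)))
  rw [Real.norm_eq_abs] at this
  refine this.trans (le_of_eq ?_)
  rw [Measure.real, Real.volume_Ioc, ENNReal.toReal_ofReal (by linarith)]
  ring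

/-- Given the first coordinate `x`, the inner integrals of `h` under `κ x` and under `F` differ by
at most `2L * M x * η`; integrating over `x` leaves the mean of `M`. -/
lemma abs_integral_mul_compProd_sub_le {F : Measure S} [IsProbabilityMeasure F] (κ : Kernel S S)
    [IsMarkovKernel κ] {M : S → ℝ} (hM : Integrable M F) {η : ℝ}
    (hκ : ∀ x, tvDist (κ x) F ≤ M x * η) {f h : S → ℝ} (hf : Measurable f) (hh : Measurable h)
    {L : ℝ} (hfL : ∀ x, |f x| ≤ L) (hhL : ∀ x, |h x| ≤ L) :
    |∫ z, f z.1 * h z.2 ∂(F ⊗ₘ κ) - ∫ z, f z.1 * h z.2 ∂(F.prod F)| ≤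
      2 * L ^ 2 * η * ∫ x, M x ∂F := by
  have hL0 : 0 ≤ L := by
    obtain ⟨x⟩ : Nonempty S := nonempty_of_isProbabilityMeasure F
    exact (abs_nonneg _).trans (hfL x)
  have hmeas : Measurable fun z : S × S => f z.1 * h z.2 :=
    (hf.comp measurable_fst).mul (hh.comp measurable_snd)
  have hbd : ∀ z : S × S, ‖f z.1 * h z.2‖ ≤ L * L := fun z => by
    rw [norm_mul]; exact mul_le_mul (hfL _) (hhL _) (norm_nonneg _) hL0
  have i1 : Integrable (fun z : S × S => f z.1 * h z.2) (F ⊗ₘ κ) :=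
    Integrable.of_bound hmeas.aestronglyMeasurable _ (ae_of_all _ hbd)
  have i2 : Integrable (fun z : S × S => f z.1 * h z.2) (F.prod F) :=
    Integrable.of_bound hmeas.aestronglyMeasurable _ (ae_of_all _ hbd)
  have j1 : Integrable (fun x => ∫ y, f x * h y ∂κ x) F := i1.integral_compProd
  have j2 : Integrable (fun x => ∫ y, f x * h y ∂F) F := i2.integral_prod_left
  rw [Measure.integral_compProd i1, integral_prod _ i2, ← integral_sub j1 j2,
    ← Real.norm_eq_abs]
  refine (norm_integral_le_of_norm_le (hM.const_mul (2 * L ^ 2 * η))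
    (ae_of_all _ fun x => ?_)).trans (le_of_eq (integral_const_mul _ _))
  rw [integral_const_mul, integral_const_mul, ← mul_sub, norm_mul]
  calc ‖f x‖ * ‖∫ y, h y ∂κ x - ∫ y, h y ∂F‖ ≤ L * (2 * L * tvDist (κ x) F) :=
        mul_le_mul (hfL x) (abs_integral_sub_le_tvDist _ _ hh hhL) (norm_nonneg _) hL0
    _ ≤ L * (2 * L * (M x * η)) := by gcongr; exact hκ x
    _ = _ := by ring

/-- Truncation of a real function at level `L`. -/
noncomputable def trunc (L : ℝ) (f : S → ℝ) (x : S) : ℝ := if |f x| ≤ L then f x else 0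

omit [MeasurableSpace S] in
lemma abs_trunc_le {L : ℝ} (hL : 0 ≤ L) (f : S → ℝ) (x : S) : |trunc L f x| ≤ L := by
  unfold trunc; split_ifs <;> simp [*]

lemma measurable_trunc {f : S → ℝ} (hf : Measurable f) (L : ℝ) : Measurable (trunc L f) :=
  Measurable.ite (measurableSet_le hf.abs measurable_const) hf measurable_const

lemma sq_le_rpow_mul {L δ c : ℝ} (hL : 0 < L) (hδ : 0 < δ) (hc : L < c) :
    c * c ≤ L ^ (-δ) * c ^ (2 + δ) := by
  have hc0 : 0 < c := hL.trans hc
  rw [Real.rpow_add hc0, Real.rpow_neg hL.le, Real.rpow_two]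
  have h1 : L ^ δ ≤ c ^ δ := Real.rpow_le_rpow hL.le hc.le hδ.le
  have h2 : 0 < L ^ δ := Real.rpow_pos_of_pos hL δ
  rw [inv_mul_eq_div, le_div_iff₀ h2]
  nlinarith [mul_pos hc0 hc0]

omit [MeasurableSpace S] in
-- Truncation sends large values to `0`, so the truncated product is either exact or zero. In the
-- latter case the larger factor `c` exceeds `L`, and the product is at most `c ^ 2 ≤ L ^ (-δ) * c ^
-- (2 + δ)`.
lemma abs_mul_sub_trunc_le {L δ : ℝ} (hL : 0 < L) (hδ : 0 < δ) (f h : S → ℝ) (x y : S) :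
    |f x * h y - trunc L f x * trunc L h y| ≤
      L ^ (-δ) * (|f x| ^ (2 + δ) + |h y| ^ (2 + δ)) := by
  have p1 : 0 ≤ |f x| ^ (2 + δ) := Real.rpow_nonneg (abs_nonneg _) _
  have p2 : 0 ≤ |h y| ^ (2 + δ) := Real.rpow_nonneg (abs_nonneg _) _
  have p0 : 0 < L ^ (-δ) := Real.rpow_pos_of_pos hL _
  by_cases hb : |f x| ≤ L ∧ |h y| ≤ L
  · simp only [trunc, hb.1, hb.2, if_true, sub_self, abs_zero]
    positivity
  have e : trunc L f x * trunc L h y = 0 := by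
    unfold trunc
    rcases not_and_or.1 hb with h1 | h1 <;> simp [h1]
  rw [e, sub_zero, abs_mul]
  rcases le_total |f x| |h y| with hle | hle
  · have hc : L < |h y| := by
      by_contra hcon
      push Not at hcon
      exact hb ⟨hle.trans hcon, hcon⟩
    calc |f x| * |h y| ≤ |h y| * |h y| := by gcongr
      _ ≤ L ^ (-δ) * |h y| ^ (2 + δ) := sq_le_rpow_mul hL hδ hc
      _ ≤ _ := by nlinarith
  · have hc : L < |f x| := by
      by_contra hcon
      push Not at hcon
      exact hb ⟨hcon, hle.trans hcon⟩
    calc |f x| * |h y| ≤ |f x| * |f x| := by gcongr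
      _ ≤ L ^ (-δ) * |f x| ^ (2 + δ) := sq_le_rpow_mul hL hδ hc
      _ ≤ _ := by nlinarith

/-- The bound sees `π` only through its marginals, so it serves both for the joint law `F ⊗ₘ κ` and
for the independent coupling `F.prod F`. -/
lemma abs_integral_mul_sub_trunc_le {F : Measure S} {π : Measure (S × S)}
    [IsProbabilityMeasure π] (h1 : π.map Prod.fst = F) (h2 : π.map Prod.snd = F)
    {f h : S → ℝ} (hf : Measurable f) (hh : Measurable h) {δ : ℝ} (hδ : 0 < δ)
    (hfi : Integrable (fun x => |f x| ^ (2 + δ)) F) (hhi : Integrable (fun x => |h x| ^ (2 + δ)) F)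
    (hfh : Integrable (fun z : S × S => f z.1 * h z.2) π) {L : ℝ} (hL : 0 < L) :
    |∫ z, f z.1 * h z.2 ∂π - ∫ z, trunc L f z.1 * trunc L h z.2 ∂π| ≤
      L ^ (-δ) * (∫ x, |f x| ^ (2 + δ) ∂F + ∫ x, |h x| ^ (2 + δ) ∂F) := by
  have hmeas : Measurable fun z : S × S => trunc L f z.1 * trunc L h z.2 :=
    ((measurable_trunc hf L).comp measurable_fst).mul ((measurable_trunc hh L).comp measurable_snd)
  have i2 : Integrable (fun z : S × S => trunc L f z.1 * trunc L h z.2) π :=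
    Integrable.of_bound hmeas.aestronglyMeasurable (L * L) (ae_of_all _ fun z => by
      rw [norm_mul]
      exact mul_le_mul (abs_trunc_le hL.le _ _) (abs_trunc_le hL.le _ _) (norm_nonneg _) hL.le)
  have jf : Integrable (fun z : S × S => |f z.1| ^ (2 + δ)) π :=
    (h1.symm ▸ hfi : Integrable (fun x => |f x| ^ (2 + δ)) (π.map Prod.fst)).comp_measurable
      measurable_fst
  have jh : Integrable (fun z : S × S => |h z.2| ^ (2 + δ)) π :=
    (h2.symm ▸ hhi : Integrable (fun x => |h x| ^ (2 + δ)) (π.map Prod.snd)).comp_measurable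
      measurable_snd
  have ef : ∫ x, |f x| ^ (2 + δ) ∂F = ∫ z : S × S, |f z.1| ^ (2 + δ) ∂π := by
    rw [← h1, integral_map measurable_fst.aemeasurable (h1 ▸ hfi.aestronglyMeasurable)]
  have eh : ∫ x, |h x| ^ (2 + δ) ∂F = ∫ z : S × S, |h z.2| ^ (2 + δ) ∂π := by
    rw [← h2, integral_map measurable_snd.aemeasurable (h2 ▸ hhi.aestronglyMeasurable)]
  rw [← integral_sub hfh i2, ef, eh, ← integral_add jf jh, ← integral_const_mul,
    ← Real.norm_eq_abs]
  exact norm_integral_le_of_norm_le ((jf.add jh).const_mul _)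
    (ae_of_all _ fun z => abs_mul_sub_trunc_le hL hδ f h z.1 z.2)

lemma memLp_two_of_integrable_rpow {F : Measure S} [IsProbabilityMeasure F] {f : S → ℝ}
    (hf : Measurable f) {δ : ℝ} (hδ : 0 < δ) (hfi : Integrable (fun x => |f x| ^ (2 + δ)) F) :
    MemLp f 2 F := by
  rw [memLp_two_iff_integrable_sq hf.aestronglyMeasurable]
  refine ((integrable_const (1 : ℝ)).add hfi).mono' (hf.pow_const 2).aestronglyMeasurable
    (ae_of_all _ fun x => ?_)
  have h0 : 0 ≤ |f x| ^ (2 + δ) := Real.rpow_nonneg (abs_nonneg _) _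
  simp only [Real.norm_eq_abs, abs_pow, Pi.add_apply]
  rcases le_total |f x| 1 with h | h
  · nlinarith [abs_nonneg (f x)]
  · have := Real.rpow_le_rpow_of_exponent_le h (by linarith : (2 : ℝ) ≤ 2 + δ)
    rw [Real.rpow_two] at this
    linarith

/-- A covariance inequality for the pair `(X₀, X₁)` with `X₀ ∼ F` and `X₁ ∼ κ X₀`. -/
lemma abs_integral_mul_compProd_sub_mul_le {F : Measure S} [IsProbabilityMeasure F]
    (κ : Kernel S S) [IsMarkovKernel κ] (hκF : κ ∘ₘ F = F) {M : S → ℝ} (hM : Integrable M F)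
    {η : ℝ} (hκ : ∀ x, tvDist (κ x) F ≤ M x * η) {f h : S → ℝ} (hf : Measurable f)
    (hh : Measurable h) {δ : ℝ} (hδ : 0 < δ)
    (hfi : Integrable (fun x => |f x| ^ (2 + δ)) F) (hhi : Integrable (fun x => |h x| ^ (2 + δ)) F)
    {L : ℝ} (hL : 0 < L) :
    |∫ z, f z.1 * h z.2 ∂(F ⊗ₘ κ) - (∫ x, f x ∂F) * ∫ x, h x ∂F| ≤
      2 * L ^ (-δ) * (∫ x, |f x| ^ (2 + δ) ∂F + ∫ x, |h x| ^ (2 + δ) ∂F) +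
        2 * L ^ 2 * η * ∫ x, M x ∂F := by
  have f2 := memLp_two_of_integrable_rpow hf hδ hfi
  have h2 := memLp_two_of_integrable_rpow hh hδ hhi
  have m1 : (F ⊗ₘ κ).map Prod.fst = F := Measure.fst_compProd F κ
  have m2 : (F ⊗ₘ κ).map Prod.snd = F := (Measure.snd_compProd F κ).trans hκF
  have n1 : (F.prod F).map Prod.fst = F := by simp [Measure.map_fst_prod]
  have n2 : (F.prod F).map Prod.snd = F := by simp [Measure.map_snd_prod]
  have hint : ∀ π : Measure (S × S), π.map Prod.fst = F → π.map Prod.snd = F →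
      Integrable (fun z : S × S => f z.1 * h z.2) π := fun π e1 e2 =>
    MemLp.integrable_mul
      ((e1.symm ▸ f2 : MemLp f 2 (π.map Prod.fst)).comp_of_map measurable_fst.aemeasurable)
      ((e2.symm ▸ h2 : MemLp h 2 (π.map Prod.snd)).comp_of_map measurable_snd.aemeasurable)
  -- Three errors: truncation under the joint law, truncation under the product law, and dependence
  -- between the truncated functions.
  have a1 := abs_integral_mul_sub_trunc_le m1 m2 hf hh hδ hfi hhi (hint _ m1 m2) hL
  have a2 := abs_integral_mul_sub_trunc_le n1 n2 hf hh hδ hfi hhi (hint _ n1 n2) hL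
  have a3 := abs_integral_mul_compProd_sub_le κ hM hκ (measurable_trunc hf L)
    (measurable_trunc hh L) (abs_trunc_le hL.le f) (abs_trunc_le hL.le h)
  rw [integral_prod_mul (μ := F) (ν := F) f h] at a2
  rw [abs_le] at *
  constructor <;> linarith [a1.1, a1.2, a2.1, a2.2, a3.1, a3.2]

/-- Covariance decay at rate `k ^ (-ξ δ / (2 + δ))`. -/
lemma abs_integral_mul_compProd_sub_mul_le_rpow {F : Measure S} [IsProbabilityMeasure F]
    (κ : Kernel S S) [IsMarkovKernel κ] (hκF : κ ∘ₘ F = F) {M : S → ℝ} (hM : Integrable M F)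
    {k ξ : ℝ} (hk : 0 < k) (hκ : ∀ x, tvDist (κ x) F ≤ M x * k ^ (-ξ)) {f h : S → ℝ}
    (hf : Measurable f) (hh : Measurable h) {δ : ℝ} (hδ : 0 < δ)
    (hfi : Integrable (fun x => |f x| ^ (2 + δ)) F)
    (hhi : Integrable (fun x => |h x| ^ (2 + δ)) F) :
    |∫ z, f z.1 * h z.2 ∂(F ⊗ₘ κ) - (∫ x, f x ∂F) * ∫ x, h x ∂F| ≤
      (2 * (∫ x, |f x| ^ (2 + δ) ∂F + ∫ x, |h x| ^ (2 + δ) ∂F) + 2 * ∫ x, M x ∂F) *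
        k ^ (-(ξ / (1 + 2 / δ))) := by
  -- The level `L = k ^ (ξ / (2 + δ))` equates `L ^ (-δ)` with `L ^ 2 * k ^ (-ξ)`.
  have := abs_integral_mul_compProd_sub_mul_le κ hκF hM hκ hf hh hδ hfi hhi
    (Real.rpow_pos_of_pos hk (ξ / (2 + δ)))
  refine this.trans (le_of_eq ?_)
  have hδ2 : 2 + δ ≠ 0 := by positivity
  have hδ1 : 1 + 2 / δ ≠ 0 := by positivity
  have e1 : (k ^ (ξ / (2 + δ))) ^ (-δ) = k ^ (-(ξ / (1 + 2 / δ))) := by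
    rw [← Real.rpow_mul hk.le]
    congr 1
    field_simp
    ring
  have e2 : (k ^ (ξ / (2 + δ))) ^ 2 * k ^ (-ξ) = k ^ (-(ξ / (1 + 2 / δ))) := by
    rw [← Real.rpow_two, ← Real.rpow_mul hk.le, ← Real.rpow_add hk]
    congr 1
    field_simp
    ring
  rw [e1, mul_assoc 2 _ (k ^ (-ξ)), e2]
  ring

end Mixing

/-! ### Two-time laws of a stationary Markov chain -/

section Chain

variable {S Ω : Type*} [MeasurableSpace S] [MeasurableSpace Ω]

lemma isMarkovKernel_pow (P : Kernel S S) [IsMarkovKernel P] (k : ℕ) : IsMarkovKernel (P ^ k) := by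
  induction k with
  | zero => exact inferInstanceAs (IsMarkovKernel Kernel.id)
  | succ k ih =>
    rw [pow_succ]
    exact inferInstanceAs (IsMarkovKernel ((P ^ k) ∘ₖ P))

lemma pow_succ_comp_measure (P : Kernel S S) (k : ℕ) (ν : Measure S) :
    (P ^ (k + 1)) ∘ₘ ν = P ∘ₘ ((P ^ k) ∘ₘ ν) := by
  rw [Measure.comp_assoc, pow_succ']
  rfl

lemma pow_zero_comp_measure (P : Kernel S S) (ν : Measure S) :
    (P ^ 0 : Kernel S S) ∘ₘ ν = ν := by
  rw [pow_zero]
  exact Measure.id_comp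

lemma pow_comp_measure_eq_of_invariant {P : Kernel S S} {F : Measure S} (h : P.Invariant F)
    (k : ℕ) : (P ^ k) ∘ₘ F = F := by
  induction k with
  | zero => exact pow_zero_comp_measure P F
  | succ k ih => rw [pow_succ_comp_measure, ih, h.def]

variable {μ : Measure Ω} {F : Measure S} {P : Kernel S S}
  {X : ℕ → Ω → S}

/-- Restricting `μ` to a past event plays the role of conditioning, which turns the Markov property
into an identity of measures that can be iterated. -/
lemma IsMarkovChain.map_restrict_succ (hX : IsMarkovChain μ P F X) {n : ℕ} {E : Set Ω}
    (hE : MeasurableSet[⨆ i : Fin (n + 1), MeasurableSpace.comap (X i) inferInstance] E) :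
    (μ.restrict E).map (X (n + 1)) = P ∘ₘ (μ.restrict E).map (X n) := by
  ext A hA
  rw [Measure.map_apply (hX.measurable _) hA,
    Measure.restrict_apply (hX.measurable _ hA), Set.inter_comm, hX.markov n E A hE hA,
    Measure.bind_apply hA P.aemeasurable,
    lintegral_map (P.measurable_coe hA) (hX.measurable n)]

lemma IsMarkovChain.map_eq (hX : IsMarkovChain μ P F X) (hPF : P.Invariant F) (t : ℕ) :
    μ.map (X t) = F := by
  induction t with
  | zero => exact hX.initial
  | succ t ih =>
    have := hX.map_restrict_succ (n := t) (E := Set.univ) MeasurableSet.univ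
    rw [Measure.restrict_univ, ih] at this
    rw [this, hPF.def]

/-- The event `X t ∈ A` belongs to the past of every later time, so the one-step identity applies
`k` times. -/
lemma IsMarkovChain.map_restrict_add (hX : IsMarkovChain μ P F X) (hPF : P.Invariant F)
    (t k : ℕ) {A : Set S} (hA : MeasurableSet A) :
    (μ.restrict (X t ⁻¹' A)).map (X (t + k)) = (P ^ k) ∘ₘ (F.restrict A) := by
  induction k with
  | zero =>
    rw [pow_zero_comp_measure, ← hX.map_eq hPF t, Measure.restrict_map (hX.measurable t) hA,
      add_zero]
  | succ k ih =>
    rw [pow_succ_comp_measure, ← ih]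
    refine hX.map_restrict_succ (n := t + k) ?_
    have : MeasurableSpace.comap (X t) inferInstance ≤
        ⨆ i : Fin (t + k + 1), MeasurableSpace.comap (X i) inferInstance :=
      le_iSup (fun i : Fin (t + k + 1) => MeasurableSpace.comap (X i) inferInstance)
        ⟨t, by omega⟩
    exact this _ ⟨A, hA, rfl⟩

lemma IsMarkovChain.map_prodMk [IsProbabilityMeasure μ] (hX : IsMarkovChain μ P F X)
    [IsMarkovKernel P]
    (hPF : P.Invariant F) (t k : ℕ) :
    μ.map (fun ω => (X t ω, X (t + k) ω)) = F ⊗ₘ (P ^ k) := by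
  have : IsMarkovKernel (P ^ k) := isMarkovKernel_pow P k
  have : IsProbabilityMeasure F := hX.map_eq hPF 0 ▸
    Measure.isProbabilityMeasure_map (hX.measurable 0).aemeasurable
  have hm := (hX.measurable t).prodMk (hX.measurable (t + k))
  have := Measure.isProbabilityMeasure_map (μ := μ) hm.aemeasurable
  refine Measure.ext_prod fun {A B} hA hB => ?_
  rw [Measure.map_apply hm (hA.prod hB), Measure.compProd_apply_prod hA hB,
    ← Measure.bind_apply hB (P ^ k).aemeasurable, ← hX.map_restrict_add hPF t k hA,
    Measure.map_apply (hX.measurable _) hB, Measure.restrict_apply (hX.measurable _ hB),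
    Set.inter_comm]
  rfl

end Chain

/-! ### Deterministic bias of windowed sums -/

section Bias

lemma summable_abs_rpow_mul {ρ : ℤ → ℝ} {C r q : ℝ} (hr : q + 1 < r)
    (hρ : ∀ k : ℤ, k ≠ 0 → |ρ k| ≤ C * |(k : ℝ)| ^ (-r)) :
    Summable fun k : ℤ => |(k : ℝ)| ^ q * ρ k := by
  refine Summable.of_norm_bounded_eventually
    ((Real.summable_abs_int_rpow (b := r - q) (by linarith)).mul_left C) ?_
  have : ∀ᶠ k : ℤ in cofinite, k ≠ 0 := (Set.finite_singleton (0 : ℤ)).eventually_cofinite_notMem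
  filter_upwards [this] with k hk
  have hk0 : 0 < |(k : ℝ)| := abs_pos.2 (by exact_mod_cast hk)
  rw [norm_mul, Real.norm_of_nonneg (Real.rpow_nonneg hk0.le q)]
  calc |(k : ℝ)| ^ q * |ρ k| ≤ |(k : ℝ)| ^ q * (C * |(k : ℝ)| ^ (-r)) := by
        gcongr; exact hρ k hk
    _ = C * (|(k : ℝ)| ^ q * |(k : ℝ)| ^ (-r)) := by ring
    _ = C * |(k : ℝ)| ^ (-(r - q)) := by rw [← Real.rpow_add hk0]; ring_nf

/-- Near `0` the limit controls the quotient; away from `0`, `|x| ^ q` is bounded below and `1 - w`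
is bounded. Requiring `1 ≤ K` lets the same constant dominate the lags outside the window. -/
lemma exists_abs_one_sub_le {w : ℝ → ℝ} {c : ℝ} (hc : ∀ x, |w x| ≤ c) {q kq : ℝ} (hq : 0 < q)
    (hkq : Tendsto (fun x : ℝ => (1 - w x) / |x| ^ q) (𝓝[≠] 0) (𝓝 kq)) :
    ∃ K : ℝ, 1 ≤ K ∧ ∀ x : ℝ, x ≠ 0 → |1 - w x| ≤ K * |x| ^ q := by
  have h1 : ∀ᶠ x in 𝓝[≠] (0 : ℝ), |(1 - w x) / |x| ^ q| < |kq| + 1 :=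
    hkq.abs.eventually_lt_const (by linarith)
  rw [eventually_nhdsWithin_iff, Metric.eventually_nhds_iff] at h1
  obtain ⟨η, hη, h1⟩ := h1
  have hηq : 0 < η ^ q := Real.rpow_pos_of_pos hη q
  refine ⟨max (|kq| + 1) ((1 + c) / η ^ q), le_max_of_le_left (by linarith [abs_nonneg kq]),
    fun x hx => ?_⟩
  have hx0 : 0 < |x| := abs_pos.2 hx
  have hxq : 0 < |x| ^ q := Real.rpow_pos_of_pos hx0 q
  rcases lt_or_ge |x| η with h | h
  · have := h1 (by simpa using h) hx
    rw [abs_div, abs_of_pos hxq, div_lt_iff₀ hxq] at this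
    exact this.le.trans (by gcongr; exact le_max_left _ _)
  · have hle : η ^ q ≤ |x| ^ q := Real.rpow_le_rpow hη.le h hq.le
    have hc0 : 0 ≤ 1 + c := by linarith [(abs_nonneg (w 0)).trans (hc 0)]
    calc |1 - w x| ≤ 1 + c := by
          refine (abs_sub _ _).trans ?_
          rw [abs_one]; linarith [hc x]
      _ = (1 + c) / η ^ q * η ^ q := by field_simp
      _ ≤ (1 + c) / η ^ q * |x| ^ q := by gcongr
      _ ≤ _ := by gcongr; exact le_max_right _ _

lemma mem_Icc_neg_iff {b : ℕ} {k : ℤ} :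
    k ∈ Finset.Icc (-(b : ℤ) + 1) ((b : ℤ) - 1) ↔ |(k : ℝ)| < b := by
  rw [Finset.mem_Icc, ← Int.cast_abs, show (b : ℝ) = ((b : ℤ) : ℝ) by simp, Int.cast_lt, abs_lt]
  omega

/-- The truncated and windowed sum of a summable sequence approaches the full sum at
rate `b ^ (-q)`. -/
lemma tendsto_windowed_sum {w : ℝ → ℝ} (hw : IsLagWindow w) {q kq : ℝ} (hq : 0 < q)
    (hkq : Tendsto (fun x : ℝ => (1 - w x) / |x| ^ q) (𝓝[≠] 0) (𝓝 kq)) {ρ : ℤ → ℝ}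
    (hρ : Summable ρ) (hρq : Summable fun k : ℤ => |(k : ℝ)| ^ q * ρ k)
    {b : ℕ → ℕ} (hb : Tendsto b atTop atTop) :
    Tendsto (fun n : ℕ => (b n : ℝ) ^ q *
      (∑ k ∈ Finset.Icc (-(b n : ℤ) + 1) ((b n : ℤ) - 1), w ((k : ℝ) / (b n : ℝ)) * ρ k -
        ∑' k, ρ k)) atTop (𝓝 (-kq * ∑' k : ℤ, |(k : ℝ)| ^ q * ρ k)) := by
  obtain ⟨c, -, hc⟩ := hw.bounded
  obtain ⟨K, hK1, hK⟩ := exists_abs_one_sub_le hc hq hkq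
  set I : ℕ → Finset ℤ := fun n => Finset.Icc (-(b n : ℤ) + 1) ((b n : ℤ) - 1) with hI
  -- Extending the weights by `0` outside the window writes the whole difference as one series over
  -- `ℤ`, including the discarded tail.
  set v : ℕ → ℤ → ℝ := fun n k =>
    (b n : ℝ) ^ q * ((if k ∈ I n then w ((k : ℝ) / (b n : ℝ)) else 0) - 1) with hv
  have e : ∀ n, (b n : ℝ) ^ q * (∑ k ∈ I n, w ((k : ℝ) / (b n : ℝ)) * ρ k - ∑' k, ρ k) =
      ∑' k, v n k * ρ k := by
    intro n
    have e1 : ∑ k ∈ I n, w ((k : ℝ) / (b n : ℝ)) * ρ k =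
        ∑' k, (if k ∈ I n then w ((k : ℝ) / (b n : ℝ)) else 0) * ρ k := by
      rw [tsum_eq_sum (s := I n) (fun k hk => by simp [hk])]
      exact Finset.sum_congr rfl fun k hk => by simp [hk]
    have s1 : Summable fun k => (if k ∈ I n then w ((k : ℝ) / (b n : ℝ)) else 0) * ρ k :=
      summable_of_ne_finset_zero (s := I n) (fun k hk => by simp [hk])
    rw [e1, ← s1.tsum_sub hρ, ← tsum_mul_left]
    exact tsum_congr fun k => by simp only [hv]; ring
  refine Tendsto.congr (fun n => (e n).symm) ?_
  rw [← tsum_mul_left]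
  have hb1 : ∀ᶠ n in atTop, 1 ≤ b n := hb.eventually_ge_atTop 1
  have hbR : Tendsto (fun n => (b n : ℝ)) atTop atTop := tendsto_natCast_atTop_atTop.comp hb
  refine tendsto_tsum_of_dominated_convergence
    (bound := fun k : ℤ => K * ‖|(k : ℝ)| ^ q * ρ k‖) (hρq.norm.mul_left K) (fun k => ?_) ?_
  · rw [← mul_assoc]
    refine Tendsto.mul_const _ ?_
    rcases eq_or_ne k 0 with rfl | hk
    · rw [Int.cast_zero, abs_zero, Real.zero_rpow hq.ne', mul_zero]
      refine tendsto_const_nhds.congr' ?_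
      filter_upwards [hb1] with n hn
      have : (0 : ℤ) ∈ I n := mem_Icc_neg_iff.2 (by simpa using by omega)
      simp [hv, this, hw.at_zero]
    · have hk0 : 0 < |(k : ℝ)| := abs_pos.2 (by exact_mod_cast hk)
      have hx : Tendsto (fun n => (k : ℝ) / (b n : ℝ)) atTop (𝓝[≠] 0) := by
        refine tendsto_nhdsWithin_iff.2 ⟨hbR.const_div_atTop _, ?_⟩
        filter_upwards [hb1] with n hn
        have : (b n : ℝ) ≠ 0 := by positivity
        exact div_ne_zero (by exact_mod_cast hk) this
      have := ((hkq.comp hx).neg).mul_const (|(k : ℝ)| ^ q)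
      refine this.congr' ?_
      filter_upwards [hb1, hbR.eventually_gt_atTop |(k : ℝ)|] with n hn hkn
      have hmem : k ∈ I n := mem_Icc_neg_iff.2 hkn
      have hbpos : (0 : ℝ) < b n := by positivity
      have p1 : (b n : ℝ) ^ q ≠ 0 := (Real.rpow_pos_of_pos hbpos q).ne'
      have p2 : |(k : ℝ)| ^ q ≠ 0 := (Real.rpow_pos_of_pos hk0 q).ne'
      simp only [hv, hmem, if_true, Function.comp, abs_div, abs_of_pos hbpos,
        Real.div_rpow hk0.le hbpos.le]
      field_simp
      ring
  · filter_upwards [hb1] with n hn k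
    have hbpos : (0 : ℝ) < b n := by positivity
    rw [norm_mul (v n k), norm_mul (|(k : ℝ)| ^ q), ← mul_assoc]
    refine mul_le_mul_of_nonneg_right ?_ (norm_nonneg _)
    rw [Real.norm_of_nonneg (Real.rpow_nonneg (abs_nonneg (k : ℝ)) q)]
    have hkq0 : 0 ≤ |(k : ℝ)| ^ q := Real.rpow_nonneg (abs_nonneg _) _
    simp only [hv, norm_mul, Real.norm_of_nonneg (Real.rpow_nonneg hbpos.le q)]
    by_cases hk : k ∈ I n
    · simp only [hk, if_true]
      rcases eq_or_ne k 0 with rfl | hk0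
      · simp only [Int.cast_zero, zero_div, hw.at_zero, sub_self, norm_zero, mul_zero]
        exact mul_nonneg (by linarith) (by simpa using hkq0)
      · have hx : (k : ℝ) / (b n : ℝ) ≠ 0 := div_ne_zero (by exact_mod_cast hk0) hbpos.ne'
        have h1 := hK _ hx
        rw [abs_div, abs_of_pos hbpos, Real.div_rpow (abs_nonneg _) hbpos.le] at h1
        rw [norm_sub_rev, Real.norm_eq_abs]
        have hbq : 0 < (b n : ℝ) ^ q := Real.rpow_pos_of_pos hbpos q
        calc (b n : ℝ) ^ q * |1 - w ((k : ℝ) / (b n : ℝ))|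
            ≤ (b n : ℝ) ^ q * (K * (|(k : ℝ)| ^ q / (b n : ℝ) ^ q)) := by gcongr
          _ = _ := by field_simp
    -- A discarded lag has weight `-b ^ q`, and `b ^ q ≤ |k| ^ q ≤ K * |k| ^ q`.
    · have hle : (b n : ℝ) ≤ |(k : ℝ)| := not_lt.1 fun h => hk (mem_Icc_neg_iff.2 h)
      have := Real.rpow_le_rpow hbpos.le hle hq.le
      simp only [hk, if_false, zero_sub, norm_neg, norm_one, mul_one]
      nlinarith

/-- Bias expansion for a windowed sum of estimates `e n k` of `ρ k` whose expectations are those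
of the usual sample autocovariances up to `O(1/n)`. -/
lemma tendsto_windowed_sum_of_approx {w : ℝ → ℝ} (hw : IsLagWindow w) {q kq : ℝ} (hq : 0 < q)
    (hkq : Tendsto (fun x : ℝ => (1 - w x) / |x| ^ q) (𝓝[≠] 0) (𝓝 kq)) {ρ : ℤ → ℝ}
    (hρ : Summable ρ) (hρq : Summable fun k : ℤ => |(k : ℝ)| ^ q * ρ k)
    {b : ℕ → ℕ} (hb : Tendsto b atTop atTop)
    (hbn : Tendsto (fun n : ℕ => (b n : ℝ) ^ (q + 1) / (n : ℝ)) atTop (𝓝 0))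
    {e : ℕ → ℤ → ℝ} {B : ℝ}
    (he : ∀ n : ℕ, 1 ≤ n → ∀ k : ℤ,
      |e n k - (((n - k.natAbs : ℕ) : ℝ) / n) * ρ k| ≤ B / n) :
    Tendsto (fun n : ℕ => (b n : ℝ) ^ q *
      (∑ k ∈ Finset.Icc (-(b n : ℤ) + 1) ((b n : ℤ) - 1), w ((k : ℝ) / (b n : ℝ)) * e n k -
        ∑' k, ρ k)) atTop (𝓝 (-kq * ∑' k : ℤ, |(k : ℝ)| ^ q * ρ k)) := by
  obtain ⟨c, hc1, hc⟩ := hw.bounded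
  have hB : 0 ≤ B := by
    have := (abs_nonneg _).trans (he 1 le_rfl 0)
    simpa using this
  have main := tendsto_windowed_sum hw hq hkq hρ hρq hb
  have herr : Tendsto (fun n : ℕ => (b n : ℝ) ^ q *
      ∑ k ∈ Finset.Icc (-(b n : ℤ) + 1) ((b n : ℤ) - 1),
        w ((k : ℝ) / (b n : ℝ)) * (e n k - ρ k)) atTop (𝓝 0) := by
    have hlim := hbn.mul_const (c * (2 * B + ∑' k, |ρ k|))
    rw [zero_mul] at hlim
    refine squeeze_zero_norm' ?_ hlim
    filter_upwards [hb.eventually_ge_atTop 1, eventually_ge_atTop 1] with n hbn1 hn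
    have hbpos : (0 : ℝ) < b n := by positivity
    have hnpos : (0 : ℝ) < n := by positivity
    set I := Finset.Icc (-(b n : ℤ) + 1) ((b n : ℤ) - 1) with hI
    have hterm : ∀ k ∈ I, ‖w ((k : ℝ) / (b n : ℝ)) * (e n k - ρ k)‖ ≤
        c * (B / n + (b n : ℝ) / n * |ρ k|) := by
      intro k hk
      rw [norm_mul]
      refine mul_le_mul (hc _) ?_ (norm_nonneg _) (by linarith)
      have h1 := he n hn k
      have hkb : |(k : ℝ)| ≤ b n := (mem_Icc_neg_iff.1 hk).le
      -- Truncated subtraction makes this factor `(1 - |k|/n)₊`, so the bound holds even when `|k| >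
      -- n`.
      have h2 : |((n - k.natAbs : ℕ) : ℝ) / n - 1| ≤ (b n : ℝ) / n := by
        have a1 : ((n - k.natAbs : ℕ) : ℝ) ≤ n := by exact_mod_cast Nat.sub_le _ _
        have a2 : (n : ℝ) ≤ ((n - k.natAbs : ℕ) : ℝ) + |(k : ℝ)| := by
          have : n ≤ (n - k.natAbs) + k.natAbs := by omega
          have h3 : (n : ℝ) ≤ ((n - k.natAbs : ℕ) : ℝ) + (k.natAbs : ℝ) := by exact_mod_cast this
          rwa [Nat.cast_natAbs, Int.cast_abs] at h3
        rw [div_sub_one hnpos.ne', abs_div, abs_of_pos hnpos]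
        gcongr
        exact abs_le.2 ⟨by linarith, by linarith⟩
      have h3 : e n k - ρ k = (e n k - (((n - k.natAbs : ℕ) : ℝ) / n) * ρ k) +
          (((n - k.natAbs : ℕ) : ℝ) / n - 1) * ρ k := by ring
      rw [h3]
      refine (norm_add_le _ _).trans (add_le_add h1 ?_)
      rw [norm_mul]
      exact mul_le_mul_of_nonneg_right h2 (norm_nonneg _)
    have hcard : (I.card : ℝ) ≤ 2 * b n := by
      have : I.card ≤ 2 * b n := by rw [hI, Int.card_Icc]; omega
      exact_mod_cast this
    have hsum : ∑ k ∈ I, |ρ k| ≤ ∑' k, |ρ k| :=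
      hρ.abs.sum_le_tsum _ fun _ _ => abs_nonneg _
    rw [norm_mul, Real.norm_of_nonneg (Real.rpow_nonneg hbpos.le q)]
    have hbq : 0 < (b n : ℝ) ^ q := Real.rpow_pos_of_pos hbpos q
    calc (b n : ℝ) ^ q * ‖∑ k ∈ I, w ((k : ℝ) / (b n : ℝ)) * (e n k - ρ k)‖
        ≤ (b n : ℝ) ^ q * ∑ k ∈ I, c * (B / n + (b n : ℝ) / n * |ρ k|) := by
          gcongr
          exact norm_sum_le_of_le _ hterm
      _ = (b n : ℝ) ^ q * (c * (I.card * (B / n) + (b n : ℝ) / n * ∑ k ∈ I, |ρ k|)) := by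
          rw [← Finset.mul_sum, Finset.sum_add_distrib, Finset.sum_const, nsmul_eq_mul,
            ← Finset.mul_sum]
      _ ≤ (b n : ℝ) ^ q * (c * (2 * b n * (B / n) + (b n : ℝ) / n * ∑' k, |ρ k|)) := by
          gcongr
      _ = (b n : ℝ) ^ (q + 1) / n * (c * (2 * B + ∑' k, |ρ k|)) := by
          rw [Real.rpow_add_one hbpos.ne']; ring
  have := main.add herr
  rw [add_zero] at this
  refine this.congr fun n => ?_
  simp_rw [mul_sub (w _)]
  rw [Finset.sum_sub_distrib]
  ring

end Bias

/-! ### Cost of estimating the mean -/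

section Centering

variable {Ω ι : Type*} [MeasurableSpace Ω] {μ : Measure Ω} [IsProbabilityMeasure μ]

/-- Centering at the sample mean instead of the true mean changes a covariance by at most
three times the absolute row sum of the covariances divided by the sample size. -/
lemma abs_integral_sub_mean_mul_sub_mean_sub_cov_le {A C : ι → Ω → ℝ}
    (hA : ∀ a, MemLp (A a) 2 μ) (hC : ∀ a, MemLp (C a) 2 μ) {α : ℝ} (hα : ∀ a, μ[A a] = α)
    {T : Finset ι} (hT : T.Nonempty) {B : ℝ}
    (hrow : ∀ a, ∑ c ∈ T, |cov[A a, C c; μ]| ≤ B) (hcol : ∀ c, ∑ a ∈ T, |cov[A a, C c; μ]| ≤ B)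
    (a c : ι) :
    |∫ ω, (A a ω - (T.card : ℝ)⁻¹ * ∑ d ∈ T, A d ω) *
        (C c ω - (T.card : ℝ)⁻¹ * ∑ d ∈ T, C d ω) ∂μ - cov[A a, C c; μ]| ≤
      3 * B / T.card := by
  have hN : (0 : ℝ) < T.card := by exact_mod_cast hT.card_pos
  set Abar : Ω → ℝ := fun ω => (T.card : ℝ)⁻¹ * ∑ d ∈ T, A d ω with hAbar
  set Cbar : Ω → ℝ := fun ω => (T.card : ℝ)⁻¹ * ∑ d ∈ T, C d ω with hCbar
  have hA2 : MemLp Abar 2 μ := (memLp_finsetSum T fun d _ => hA d).const_mul _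
  have hC2 : MemLp Cbar 2 μ := (memLp_finsetSum T fun d _ => hC d).const_mul _
  -- The common mean `α` makes the first centered factor have mean zero; this alone turns the
  -- integral of the product into a covariance.
  have hmean : ∫ ω, (A a ω - Abar ω) ∂μ = 0 := by
    rw [integral_sub ((hA a).integrable one_le_two) (hA2.integrable one_le_two), hα a, hAbar,
      integral_const_mul, integral_finsetSum _ fun d _ => (hA d).integrable one_le_two]
    simp only [hα, Finset.sum_const, nsmul_eq_mul]
    field_simp
    ring
  have e0 : ∫ ω, (A a ω - Abar ω) * (C c ω - Cbar ω) ∂μ =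
      cov[fun ω => A a ω - Abar ω, fun ω => C c ω - Cbar ω; μ] := by
    have := covariance_eq_sub (μ := μ) ((hA a).sub hA2) ((hC c).sub hC2)
    have h0 : μ[A a - Abar] = 0 := hmean
    rw [h0, zero_mul, sub_zero] at this
    exact this.symm
  have r1 : ∀ a, |cov[A a, Cbar; μ]| ≤ B / T.card := by
    intro a
    rw [hCbar, covariance_const_mul_right, covariance_fun_sum_right' (fun d _ => hC d) (hA a),
      abs_mul, abs_of_pos (inv_pos.2 hN), inv_mul_eq_div]
    gcongr
    exact (Finset.abs_sum_le_sum_abs _ _).trans (hrow a)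
  have r2 : |cov[Abar, C c; μ]| ≤ B / T.card := by
    rw [hAbar, covariance_const_mul_left, covariance_fun_sum_left' (fun d _ => hA d) (hC c),
      abs_mul, abs_of_pos (inv_pos.2 hN), inv_mul_eq_div]
    gcongr
    exact (Finset.abs_sum_le_sum_abs _ _).trans (hcol c)
  -- Averaging the bound `r1` over the first index costs nothing.
  have r3 : |cov[Abar, Cbar; μ]| ≤ B / T.card := by
    rw [hAbar, covariance_const_mul_left, covariance_fun_sum_left' (fun d _ => hA d) hC2,
      abs_mul, abs_of_pos (inv_pos.2 hN), inv_mul_eq_div, div_le_iff₀ hN]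
    refine (Finset.abs_sum_le_sum_abs _ _).trans ((Finset.sum_le_card_nsmul T _ _
      fun d _ => r1 d).trans (le_of_eq ?_))
    rw [nsmul_eq_mul]
    ring
  -- Bilinearity leaves the target covariance plus three terms involving a sample mean, whence the
  -- factor `3`.
  rw [e0, covariance_fun_sub_fun_sub (hA a) hA2 (hC c) hC2]
  have r1a := r1 a
  have e3 : 3 * B / T.card = B / T.card + B / T.card + B / T.card := by ring
  rw [e3]
  rw [abs_le] at *
  constructor <;> linarith [r1a.1, r1a.2, r2.1, r2.2, r3.1, r3.2]

end Centering

/-! ### Two-sided sequences and sums over lags -/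

section Autocov

lemma autocov_natCast {p : ℕ} {Ω : Type*} [MeasurableSpace Ω] (μ : Measure Ω)
    (Z : ℕ → Ω → EuclideanSpace ℝ (Fin p)) (k : ℕ) (i j : Fin p) :
    autocov μ Z k i j = cov[fun ω => Z 0 ω i, fun ω => Z k ω j; μ] := by
  simp [autocov, twoSided]

/-- At `k = 0` the untransposed branch is taken, hence the symmetry required at lag zero. -/
lemma twoSided_neg {p : ℕ} (A : ℕ → Matrix (Fin p) (Fin p) ℝ) (k : ℕ) (i j : Fin p)
    (h : ∀ i j, A 0 i j = A 0 j i) : twoSided A (-k) i j = A k j i := by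
  unfold twoSided
  rcases Nat.eq_zero_or_pos k with rfl | hk
  · simpa using h i j
  · rw [if_neg (by omega)]
    simp

lemma autocov_neg_natCast {p : ℕ} {Ω : Type*} [MeasurableSpace Ω] (μ : Measure Ω)
    (Z : ℕ → Ω → EuclideanSpace ℝ (Fin p)) (k : ℕ) (i j : Fin p) :
    autocov μ Z (-k) i j = cov[fun ω => Z 0 ω j, fun ω => Z k ω i; μ] := by
  rw [autocov, twoSided_neg _ _ _ _ fun i j => ?_]
  · simp
  · simpa using covariance_comm _ _

lemma gAcvf_zero_comm {m p : ℕ} (n : ℕ) (y : Fin m → ℕ → EuclideanSpace ℝ (Fin p)) (s : Fin m)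
    (i j : Fin p) : gAcvf n y s 0 i j = gAcvf n y s 0 j i := by
  simp [gAcvf, Matrix.sum_apply, Matrix.vecMulVec_apply, mul_comm]

lemma sum_abs_sub_left_le {ρ : ℤ → ℝ} (hρ : Summable ρ) (T : Finset ℕ) (t : ℕ) :
    ∑ u ∈ T, |ρ ((u : ℤ) - t)| ≤ ∑' k, |ρ k| := by
  have hinj : Set.InjOn (fun u : ℕ => (u : ℤ) - t) T := fun x _ y _ h => by
    simp only at h
    omega
  rw [← Finset.sum_image (f := fun k => |ρ k|) hinj]
  exact hρ.abs.sum_le_tsum _ fun _ _ => abs_nonneg _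

lemma sum_abs_sub_right_le {ρ : ℤ → ℝ} (hρ : Summable ρ) (T : Finset ℕ) (t : ℕ) :
    ∑ u ∈ T, |ρ ((t : ℤ) - u)| ≤ ∑' k, |ρ k| := by
  have hinj : Set.InjOn (fun u : ℕ => (t : ℤ) - u) T := fun x _ y _ h => by
    simp only at h
    omega
  rw [← Finset.sum_image (f := fun k => |ρ k|) hinj]
  exact hρ.abs.sum_le_tsum _ fun _ _ => abs_nonneg _

end Autocov

/-! ### Expectation of the globally centered estimator -/

section Estimator

variable {m p : ℕ} {Ω : Type*} [MeasurableSpace Ω] {μ : Measure Ω}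
  {Y : Fin m → ℕ → Ω → EuclideanSpace ℝ (Fin p)}

lemma globalMean_apply (n : ℕ) (y : Fin m → ℕ → EuclideanSpace ℝ (Fin p)) (i : Fin p) :
    globalMean n y i = ((Finset.univ ×ˢ Finset.range n : Finset (Fin m × ℕ)).card : ℝ)⁻¹ *
      ∑ d ∈ (Finset.univ ×ˢ Finset.range n : Finset (Fin m × ℕ)), y d.1 d.2 i := by
  simp only [globalMean, chainMean, PiLp.smul_apply, WithLp.ofLp_sum, Finset.sum_apply,
    smul_eq_mul, Finset.card_product, Finset.card_univ, Fintype.card_fin, Finset.card_range,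
    Finset.sum_product, Nat.cast_mul, mul_inv, ← Finset.mul_sum]
  ring

lemma memLp_globalMean (hY : ∀ s t i, MemLp (fun ω => Y s t ω i) 2 μ) (n : ℕ) (i : Fin p) :
    MemLp (fun ω => globalMean n (fun s t => Y s t ω) i) 2 μ := by
  simp only [globalMean_apply]
  exact (memLp_finsetSum _ fun (d : Fin m × ℕ) _ => hY d.1 d.2 i).const_mul _

lemma gAcvf_apply (n : ℕ) (y : Fin m → ℕ → EuclideanSpace ℝ (Fin p)) (s : Fin m) (k : ℕ)
    (i j : Fin p) :
    gAcvf n y s k i j = (n : ℝ)⁻¹ * ∑ t ∈ Finset.range (n - k),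
      (y s t i - globalMean n y i) * (y s (t + k) j - globalMean n y j) := by
  simp [gAcvf, Matrix.sum_apply, Matrix.vecMulVec_apply]

lemma integrable_centered_mul (hY : ∀ s t i, MemLp (fun ω => Y s t ω i) 2 μ) (n : ℕ) (s : Fin m)
    (t u : ℕ) (i j : Fin p) :
    Integrable (fun ω => (Y s t ω i - globalMean n (fun s t => Y s t ω) i) *
      (Y s u ω j - globalMean n (fun s t => Y s t ω) j)) μ :=
  ((hY s t i).sub (memLp_globalMean hY n i)).integrable_mul
    ((hY s u j).sub (memLp_globalMean hY n j))

lemma integrable_gAcvf (hY : ∀ s t i, MemLp (fun ω => Y s t ω i) 2 μ) (n : ℕ) (s : Fin m)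
    (k : ℕ) (i j : Fin p) : Integrable (fun ω => gAcvf n (fun s t => Y s t ω) s k i j) μ := by
  simp only [gAcvf_apply]
  exact (integrable_finsetSum _ fun t _ =>
    integrable_centered_mul hY n s t (t + k) i j).const_mul _

lemma integrable_twoSided_gAcvf (hY : ∀ s t i, MemLp (fun ω => Y s t ω i) 2 μ) (n : ℕ)
    (s : Fin m) (k : ℤ) (i j : Fin p) :
    Integrable (fun ω => twoSided (gAcvf n (fun s t => Y s t ω) s) k i j) μ := by
  unfold twoSided
  split_ifs
  · exact integrable_gAcvf hY n s _ i j
  · exact integrable_gAcvf hY n s _ j i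

lemma gAcvfAvg_apply (n : ℕ) (y : Fin m → ℕ → EuclideanSpace ℝ (Fin p)) (k : ℤ) (i j : Fin p) :
    gAcvfAvg n y k i j = (m : ℝ)⁻¹ * ∑ s, twoSided (gAcvf n y s) k i j := by
  simp [gAcvfAvg, Matrix.sum_apply]

lemma gsv_apply (w : ℝ → ℝ) (b n : ℕ) (y : Fin m → ℕ → EuclideanSpace ℝ (Fin p))
    (i j : Fin p) :
    gsv w b n y i j = ∑ k ∈ Finset.Icc (-(b : ℤ) + 1) ((b : ℤ) - 1),
      w ((k : ℝ) / (b : ℝ)) * gAcvfAvg n y k i j := by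
  simp [gsv, Matrix.sum_apply]

lemma integrable_gAcvfAvg (hY : ∀ s t i, MemLp (fun ω => Y s t ω i) 2 μ) (n : ℕ) (k : ℤ)
    (i j : Fin p) : Integrable (fun ω => gAcvfAvg n (fun s t => Y s t ω) k i j) μ := by
  simp only [gAcvfAvg_apply]
  exact (integrable_finsetSum _ fun s _ => integrable_twoSided_gAcvf hY n s k i j).const_mul _

lemma integrable_gsv (hY : ∀ s t i, MemLp (fun ω => Y s t ω i) 2 μ) (w : ℝ → ℝ) (b n : ℕ)
    (i j : Fin p) : Integrable (fun ω => gsv w b n (fun s t => Y s t ω) i j) μ := by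
  simp only [gsv_apply]
  exact integrable_finsetSum _ fun k _ => (integrable_gAcvfAvg hY n k i j).const_mul _

lemma integral_gsv (hY : ∀ s t i, MemLp (fun ω => Y s t ω i) 2 μ) (w : ℝ → ℝ) (b n : ℕ)
    (i j : Fin p) : ∫ ω, gsv w b n (fun s t => Y s t ω) i j ∂μ =
      ∑ k ∈ Finset.Icc (-(b : ℤ) + 1) ((b : ℤ) - 1),
        w ((k : ℝ) / (b : ℝ)) * ∫ ω, gAcvfAvg n (fun s t => Y s t ω) k i j ∂μ := by
  simp only [gsv_apply]
  rw [integral_finsetSum _ fun k _ => (integrable_gAcvfAvg hY n k i j).const_mul _]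
  simp only [integral_const_mul]

variable [IsProbabilityMeasure μ] [NeZero m] {α : Fin p → ℝ} {R : Fin p → Fin p → ℤ → ℝ} {B : ℝ}

/-- The expectation of the globally centered autocovariance estimator of one chain, up to
`O(1/n)`. -/
lemma abs_integral_gAcvf_sub_le (hY : ∀ s t i, MemLp (fun ω => Y s t ω i) 2 μ)
    (hα : ∀ s t i, ∫ ω, Y s t ω i ∂μ = α i)
    (hR : ∀ s s' t t' i j, cov[fun ω => Y s t ω i, fun ω => Y s' t' ω j; μ] =
      if s = s' then R i j ((t' : ℤ) - t) else 0)
    (hsum : ∀ i j, Summable (R i j)) (hB : ∀ i j, ∑' k, |R i j k| ≤ B) {n : ℕ} (hn : 1 ≤ n)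
    (s : Fin m) (k : ℕ) (i j : Fin p) :
    |∫ ω, gAcvf n (fun s t => Y s t ω) s k i j ∂μ - (((n - k : ℕ) : ℝ) / n) * R i j k| ≤
      3 * B / n := by
  have hB0 : 0 ≤ B := (tsum_nonneg fun _ => abs_nonneg _).trans (hB i j)
  have hnpos : (0 : ℝ) < n := by positivity
  set T : Finset (Fin m × ℕ) := Finset.univ ×ˢ Finset.range n with hT
  have hTne : T.Nonempty := ⟨(0, 0), by simp [hT]; omega⟩
  have hcard : (n : ℝ) ≤ T.card := by
    have : n ≤ T.card := by
      rw [hT, Finset.card_product, Finset.card_univ, Fintype.card_fin, Finset.card_range]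
      exact Nat.le_mul_of_pos_left n (Nat.pos_of_ne_zero (NeZero.ne m))
    exact_mod_cast this
  -- Only observations of the same chain are correlated, and distinct times give distinct lags, so
  -- the row sum is part of one absolutely convergent series.
  have hrow : ∀ a : Fin m × ℕ,
      ∑ c ∈ T, |cov[fun ω => Y a.1 a.2 ω i, fun ω => Y c.1 c.2 ω j; μ]| ≤ B := by
    intro a
    simp only [hR, hT, Finset.sum_product]
    rw [Finset.sum_eq_single a.1 (fun s _ hs => by simp [hs.symm]) (by simp)]
    simp only [if_true]
    exact (sum_abs_sub_left_le (hsum i j) _ _).trans (hB i j)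
  have hcol : ∀ c : Fin m × ℕ,
      ∑ a ∈ T, |cov[fun ω => Y a.1 a.2 ω i, fun ω => Y c.1 c.2 ω j; μ]| ≤ B := by
    intro c
    simp only [hR, hT, Finset.sum_product]
    rw [Finset.sum_eq_single c.1 (fun s _ hs => by simp [hs]) (by simp)]
    simp only [if_true]
    exact (sum_abs_sub_right_le (hsum i j) _ _).trans (hB i j)
  have hterm : ∀ t : ℕ, |∫ ω, (Y s t ω i - globalMean n (fun s t => Y s t ω) i) *
      (Y s (t + k) ω j - globalMean n (fun s t => Y s t ω) j) ∂μ - R i j k| ≤ 3 * B / n := by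
    intro t
    have := abs_integral_sub_mean_mul_sub_mean_sub_cov_le (μ := μ)
      (A := fun (a : Fin m × ℕ) ω => Y a.1 a.2 ω i) (C := fun (a : Fin m × ℕ) ω => Y a.1 a.2 ω j)
      (fun a => hY _ _ i) (fun a => hY _ _ j) (fun a => hα _ _ i) hTne hrow hcol
      (s, t) (s, t + k)
    simp only [hR, if_true, Nat.cast_add, add_sub_cancel_left] at this
    simp only [globalMean_apply, ← hT]
    -- The centering bound has denominator `mn`, weakened here to `n`.
    refine this.trans ?_
    gcongr
  simp only [gAcvf_apply]
  rw [integral_const_mul, integral_finsetSum _ fun t _ =>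
    integrable_centered_mul hY n s t (t + k) i j]
  have e : (((n - k : ℕ) : ℝ) / n) * R i j k =
      (n : ℝ)⁻¹ * ∑ t ∈ Finset.range (n - k), R i j k := by
    rw [Finset.sum_const, Finset.card_range, nsmul_eq_mul]
    ring
  rw [e, ← mul_sub, ← Finset.sum_sub_distrib, abs_mul, abs_of_pos (inv_pos.2 hnpos),
    inv_mul_le_iff₀ hnpos]
  refine (Finset.abs_sum_le_sum_abs _ _).trans ((Finset.sum_le_card_nsmul _ _ _
    fun t _ => hterm t).trans ?_)
  rw [nsmul_eq_mul, Finset.card_range]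
  gcongr
  exact Nat.sub_le _ _

lemma abs_integral_gAcvfAvg_sub_le (hY : ∀ s t i, MemLp (fun ω => Y s t ω i) 2 μ)
    (hα : ∀ s t i, ∫ ω, Y s t ω i ∂μ = α i)
    (hR : ∀ s s' t t' i j, cov[fun ω => Y s t ω i, fun ω => Y s' t' ω j; μ] =
      if s = s' then R i j ((t' : ℤ) - t) else 0)
    (hRneg : ∀ i j k, R i j (-k) = R j i k)
    (hsum : ∀ i j, Summable (R i j)) (hB : ∀ i j, ∑' k, |R i j k| ≤ B) {n : ℕ} (hn : 1 ≤ n)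
    (k : ℤ) (i j : Fin p) :
    |∫ ω, gAcvfAvg n (fun s t => Y s t ω) k i j ∂μ -
      (((n - k.natAbs : ℕ) : ℝ) / n) * R i j k| ≤ 3 * B / n := by
  have hm : (0 : ℝ) < m := by exact_mod_cast Nat.pos_of_ne_zero (NeZero.ne m)
  have hs : ∀ s : Fin m, |∫ ω, twoSided (gAcvf n (fun s t => Y s t ω) s) k i j ∂μ -
      (((n - k.natAbs : ℕ) : ℝ) / n) * R i j k| ≤ 3 * B / n := by
    intro s
    obtain ⟨l, rfl | rfl⟩ := k.eq_nat_or_neg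
    · simpa [twoSided] using abs_integral_gAcvf_sub_le hY hα hR hsum hB hn s l i j
    · simp only [twoSided_neg _ _ _ _ (gAcvf_zero_comm n _ s), hRneg, Int.natAbs_neg,
        Int.natAbs_natCast]
      exact abs_integral_gAcvf_sub_le hY hα hR hsum hB hn s l j i
  simp only [gAcvfAvg_apply]
  rw [integral_const_mul, integral_finsetSum _ fun s _ => integrable_twoSided_gAcvf hY n s k i j]
  set x := (((n - k.natAbs : ℕ) : ℝ) / n) * R i j k with hx
  have e : x = (m : ℝ)⁻¹ * ∑ s : Fin m, x := by
    rw [Finset.sum_const, Finset.card_univ, Fintype.card_fin, nsmul_eq_mul]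
    field_simp
  rw [e, ← mul_sub, ← Finset.sum_sub_distrib, abs_mul, abs_of_pos (inv_pos.2 hm),
    inv_mul_le_iff₀ hm]
  refine (Finset.abs_sum_le_sum_abs _ _).trans ((Finset.sum_le_card_nsmul _ _ _
    fun s _ => hs s).trans ?_)
  rw [nsmul_eq_mul, Finset.card_univ, Fintype.card_fin]

end Estimator

end GSV

/-! ### Assembly, entry by entry -/

theorem theorem4
    {𝒳 : Type*} [MeasurableSpace 𝒳] {Ω : Type*} [MeasurableSpace Ω]
    (μ : Measure Ω) [IsProbabilityMeasure μ]
    -- the target distribution and an invariant Markov kernel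
    (F : Measure 𝒳) [IsProbabilityMeasure F]
    (P : Kernel 𝒳 𝒳) [IsMarkovKernel P] (hPF : P.Invariant F)
    -- `m ≥ 1` independent stationary chains
    (m : ℕ) [NeZero m] (X : Fin m → ℕ → Ω → 𝒳)
    (hX : ∀ s, GSV.IsMarkovChain μ P F (X s))
    (hindep : iIndepFun (fun (s : Fin m) (ω : Ω) (t : ℕ) => X s t ω) μ)
    -- the observed process `Y s t = g (X s t)`
    (p : ℕ) (g : 𝒳 → EuclideanSpace ℝ (Fin p)) (hg : Measurable g)
    (Y : Fin m → ℕ → Ω → EuclideanSpace ℝ (Fin p)) (hY : ∀ s t ω, Y s t ω = g (X s t ω))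
    -- lag window and its behaviour at the origin
    (w : ℝ → ℝ) (hw : GSV.IsLagWindow w)
    (q : ℝ) (hq : 0 < q) (kq : ℝ)
    (hkq : Tendsto (fun x : ℝ => (1 - w x) / |x| ^ q) (𝓝[≠] 0) (𝓝 kq))
    -- moment and mixing conditions
    (δ : ℝ) (hδ : 0 < δ) (hmom : Integrable (fun x => ‖g x‖ ^ (2 + δ)) F)
    (ξ ε : ℝ) (hε : 0 < ε) (hξ : (q + 1 + ε) * (1 + 2 / δ) < ξ)
    (hpoly : GSV.PolynomiallyErgodic P F ξ)
    -- truncation points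
    (b : ℕ → ℕ) (hb : Tendsto b atTop atTop)
    (hbn : Tendsto (fun n : ℕ => (b n : ℝ) ^ (q + 1) / (n : ℝ)) atTop (𝓝 0)) :
    Summable (GSV.autocov μ (Y 0)) ∧
    Summable (fun k : ℤ => (|(k : ℝ)| ^ q) • GSV.autocov μ (Y 0) k) ∧
    (∀ (n : ℕ) (i j : Fin p),
      Integrable (fun ω => GSV.gsv w (b n) n (fun s t => Y s t ω) i j) μ) ∧
    Tendsto
      (fun n : ℕ => ((b n : ℝ) ^ q) •
        GSV.expect μ (fun ω =>
          GSV.gsv w (b n) n (fun s t => Y s t ω) - GSV.longRunVar μ (Y 0)))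
      atTop (𝓝 (-kq • GSV.phi μ (Y 0) q)) := by
  obtain ⟨M, -, hMi, hM⟩ := hpoly
  have hgm : ∀ i, Measurable fun x => g x i := fun i =>
    (EuclideanSpace.proj (𝕜 := ℝ) i).continuous.measurable.comp hg
  have hgi : ∀ i, Integrable (fun x => |g x i| ^ (2 + δ)) F := fun i =>
    hmom.mono' (((hgm i).abs.pow_const _).aestronglyMeasurable) (ae_of_all _ fun x => by
      rw [Real.norm_of_nonneg (Real.rpow_nonneg (abs_nonneg _) _)]
      exact Real.rpow_le_rpow (abs_nonneg _) (PiLp.norm_apply_le (g x) i) (by linarith))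
  have hg2 : ∀ i, MemLp (fun x => g x i) 2 F := fun i =>
    GSV.memLp_two_of_integrable_rpow (hgm i) hδ (hgi i)
  have hYeq : ∀ s t i, (fun ω => Y s t ω i) = (fun x => g x i) ∘ X s t := fun s t i => by
    funext ω
    simp [hY]
  have hlaw : ∀ s t, μ.map (X s t) = F := fun s t => (hX s).map_eq hPF t
  have hY2 : ∀ s t i, MemLp (fun ω => Y s t ω i) 2 μ := fun s t i => by
    rw [hYeq]
    exact MemLp.comp_of_map ((hlaw s t).symm ▸ hg2 i) ((hX s).measurable t).aemeasurable
  have hmean : ∀ s t i, ∫ ω, Y s t ω i ∂μ = ∫ x, g x i ∂F := fun s t i => by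
    rw [← hlaw s t, integral_map ((hX s).measurable t).aemeasurable
      (hgm i).aestronglyMeasurable, hYeq]
    rfl
  have hcov : ∀ s t k i j, cov[fun ω => Y s t ω i, fun ω => Y s (t + k) ω j; μ] =
      cov[fun z : 𝒳 × 𝒳 => g z.1 i, fun z => g z.2 j; F ⊗ₘ (P ^ k)] := fun s t k i j => by
    rw [← (hX s).map_prodMk hPF t k, covariance_map_fun (X := fun z : 𝒳 × 𝒳 => g z.1 i)
      (Y := fun z : 𝒳 × 𝒳 => g z.2 j) ((hgm i).comp measurable_fst).aestronglyMeasurable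
      ((hgm j).comp measurable_snd).aestronglyMeasurable
      (((hX s).measurable t).prodMk ((hX s).measurable (t + k))).aemeasurable, hYeq, hYeq]
    rfl
  set R : Fin p → Fin p → ℤ → ℝ := fun i j k => GSV.autocov μ (Y 0) k i j with hRdef
  have hRnat : ∀ i j (k : ℕ), R i j k =
      cov[fun z : 𝒳 × 𝒳 => g z.1 i, fun z => g z.2 j; F ⊗ₘ (P ^ k)] := fun i j k => by
    simp only [hRdef, GSV.autocov_natCast]
    simpa using hcov 0 0 k i j
  have hRneg : ∀ i j k, R i j (-k) = R j i k := by
    intro i j k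
    obtain ⟨l, rfl | rfl⟩ := k.eq_nat_or_neg
    · simp only [hRdef, GSV.autocov_natCast, GSV.autocov_neg_natCast]
    · simp only [hRdef, neg_neg, GSV.autocov_natCast, GSV.autocov_neg_natCast]
  -- Stationarity reduces same-chain covariances to the lag, with symmetry for negative lags;
  -- independence kills the cross-chain ones.
  have hR : ∀ s s' t t' i j, cov[fun ω => Y s t ω i, fun ω => Y s' t' ω j; μ] =
      if s = s' then R i j ((t' : ℤ) - t) else 0 := by
    intro s s' t t' i j
    split_ifs with hs
    · subst hs
      rcases le_total t t' with h | h
      · obtain ⟨k, rfl⟩ := Nat.exists_eq_add_of_le h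
        rw [hcov, Nat.cast_add, add_sub_cancel_left, hRnat]
      · obtain ⟨k, rfl⟩ := Nat.exists_eq_add_of_le h
        rw [covariance_comm, hcov, Nat.cast_add, sub_add_cancel_left, hRneg, hRnat]
    · have h1 := (hindep.indepFun hs).comp ((hgm i).comp (measurable_pi_apply t))
        ((hgm j).comp (measurable_pi_apply t'))
      refine IndepFun.covariance_eq_zero ?_ (hY2 s t i) (hY2 s' t' j)
      rw [hYeq, hYeq]
      exact h1
  have hdecay_nat : ∀ i j, ∀ k : ℕ, 1 ≤ k → |R i j k| ≤
      (2 * (∫ x, |g x i| ^ (2 + δ) ∂F + ∫ x, |g x j| ^ (2 + δ) ∂F) + 2 * ∫ x, M x ∂F) *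
        (k : ℝ) ^ (-(ξ / (1 + 2 / δ))) := by
    intro i j k hk
    have := GSV.isMarkovKernel_pow P k
    have hinv := GSV.pow_comp_measure_eq_of_invariant hPF k
    have m1 : (F ⊗ₘ (P ^ k)).map Prod.fst = F := Measure.fst_compProd F (P ^ k)
    have m2 : (F ⊗ₘ (P ^ k)).map Prod.snd = F := (Measure.snd_compProd F (P ^ k)).trans hinv
    have l1 : MemLp (fun z : 𝒳 × 𝒳 => g z.1 i) 2 (F ⊗ₘ (P ^ k)) :=
      MemLp.comp_of_map (f := Prod.fst) (m1.symm ▸ hg2 i) measurable_fst.aemeasurable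
    have l2 : MemLp (fun z : 𝒳 × 𝒳 => g z.2 j) 2 (F ⊗ₘ (P ^ k)) :=
      MemLp.comp_of_map (f := Prod.snd) (m2.symm ▸ hg2 j) measurable_snd.aemeasurable
    have i1 : ∫ z : 𝒳 × 𝒳, g z.1 i ∂(F ⊗ₘ (P ^ k)) = ∫ x, g x i ∂F := by
      conv_rhs => rw [← m1]
      rw [integral_map measurable_fst.aemeasurable (hgm i).aestronglyMeasurable]
    have i2 : ∫ z : 𝒳 × 𝒳, g z.2 j ∂(F ⊗ₘ (P ^ k)) = ∫ x, g x j ∂F := by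
      conv_rhs => rw [← m2]
      rw [integral_map measurable_snd.aemeasurable (hgm j).aestronglyMeasurable]
    rw [hRnat, covariance_eq_sub l1 l2, i1, i2]
    exact GSV.abs_integral_mul_compProd_sub_mul_le_rpow (P ^ k) hinv hMi
      (by exact_mod_cast hk) (fun x => hM x k hk) (hgm i) (hgm j) hδ (hgi i) (hgi j)
  have hdecay : ∀ i j, ∀ k : ℤ, k ≠ 0 → |R i j k| ≤
      (2 * (∫ x, |g x i| ^ (2 + δ) ∂F + ∫ x, |g x j| ^ (2 + δ) ∂F) + 2 * ∫ x, M x ∂F) *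
        |(k : ℝ)| ^ (-(ξ / (1 + 2 / δ))) := by
    intro i j k hk
    obtain ⟨l, rfl | rfl⟩ := k.eq_nat_or_neg
    · simpa using hdecay_nat i j l (by omega)
    · rw [hRneg]
      simpa [add_comm] using hdecay_nat j i l (by omega)
  have hr : q + 1 < ξ / (1 + 2 / δ) := by
    have : 0 < 1 + 2 / δ := by positivity
    rw [lt_div_iff₀ this]
    nlinarith
  have hsumq : ∀ i j, Summable fun k : ℤ => |(k : ℝ)| ^ q * R i j k := fun i j =>
    GSV.summable_abs_rpow_mul hr (hdecay i j)
  have hsum : ∀ i j, Summable (R i j) := fun i j => by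
    simpa using GSV.summable_abs_rpow_mul (q := 0) (by linarith) (hdecay i j)
  have hS1 : Summable (GSV.autocov μ (Y 0)) :=
    Pi.summable.2 fun i => Pi.summable.2 fun j => hsum i j
  have hS2 : Summable (fun k : ℤ => (|(k : ℝ)| ^ q) • GSV.autocov μ (Y 0) k) :=
    Pi.summable.2 fun i => Pi.summable.2 fun j => hsumq i j
  -- Summing over the finitely many entries gives one constant valid for all of them.
  have hB : ∀ i j, ∑' k, |R i j k| ≤ ∑ i, ∑ j, ∑' k, |R i j k| := fun i j =>
    (Finset.single_le_sum (f := fun j => ∑' k, |R i j k|)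
      (fun _ _ => tsum_nonneg fun _ => abs_nonneg _) (Finset.mem_univ j)).trans
    (Finset.single_le_sum (f := fun i => ∑ j, ∑' k, |R i j k|)
      (fun _ _ => Finset.sum_nonneg fun _ _ => tsum_nonneg fun _ => abs_nonneg _)
      (Finset.mem_univ i))
  refine ⟨hS1, hS2, fun n i j => GSV.integrable_gsv hY2 w (b n) n i j, ?_⟩
  refine tendsto_pi_nhds.2 fun i => tendsto_pi_nhds.2 fun j => ?_
  have hlim := GSV.tendsto_windowed_sum_of_approx hw hq hkq (hsum i j) (hsumq i j) hb hbn
    (fun n hn k => GSV.abs_integral_gAcvfAvg_sub_le hY2 hmean hR hRneg hsum hB hn k i j)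
  have hsigma : GSV.longRunVar μ (Y 0) i j = ∑' k, R i j k :=
    (congrFun (tsum_apply hS1 (x := i)) j).trans (tsum_apply (Pi.summable.1 hS1 i))
  have hphi : GSV.phi μ (Y 0) q i j = ∑' k : ℤ, |(k : ℝ)| ^ q * R i j k :=
    (congrFun (tsum_apply hS2 (x := i)) j).trans (tsum_apply (Pi.summable.1 hS2 i))
  have ev : (-kq • GSV.phi μ (Y 0) q) i j = -kq * ∑' k : ℤ, |(k : ℝ)| ^ q * R i j k := by
    rw [Matrix.smul_apply, hphi, smul_eq_mul]
  rw [ev]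
  refine hlim.congr fun n => ?_
  rw [Matrix.smul_apply, smul_eq_mul]
  simp only [GSV.expect, Matrix.of_apply, Matrix.sub_apply]
  rw [integral_sub (GSV.integrable_gsv hY2 w (b n) n i j) (integrable_const _),
    GSV.integral_gsv hY2, hsigma]
  simp
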